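/- **Theorem (Imprecise Sklar's Theorem for fixed margins).** Let $\overline{\mathbb R}=\mathbb R\cup\{-\infty,\infty\}$ and $\mathbb I=[0,1]$. *Definitions.* A rectangle $R$ with vertices $\mathbf a=(x_1,y_1)$, $\mathbf b=(x_2,y_1)$, $\mathbf c=(x_2,y_2)$, $\mathbf d=(x_1,y_2)$, where $x_1<x_2$ and $y_1<y_2$, has $F$-volume $V_F(R)=F(\mathbf a)+F(\mathbf c)-F(\mathbf b)-F(\mathbf d)$. A function $F:\overline{\mathbb R}^2\to[0,1]$ with $F(x,-\infty)=F(-\infty,y)=0$ for all $x,y$ and $F(\infty,\infty)=1$ is a *distribution* if $V_F(R)\ge 0$ for every rectangle $R\subseteq\overline{\mathbb R}^2$, and a *quasi-distribution* if $V_F(R)\ge0$ for every rectangle $R$ that contains a point with an infinite coordinate. Its margins are $x\mapsto F(x,\infty)$ and $y\mapsto F(\infty,y)$. A *univariate distribution* is an increasing function $\overline{\mathbb R}\to[0,1]$ with value $0$ at $-\infty$ and $1$ at $\infty$. No one-sided continuity is required. A *copula* is a function $C:\mathbb I^2\to\mathbb I$ with $C(u,0)=C(0,v)=0$, $C(u,1)=u$,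 $C(1,v)=v$ and nonnegative volume on every rectangle in $\mathbb I^2$; in a *quasi-copula* the last condition is replaced by being increasing in each variable and satisfying $|C(u,v)-C(u',v')|\le|u-u'|+|v-v'|$. All orders, infima and suprema of functions are pointwise. A pair $(P,Q)$ of quasi-copulas with $P\le Q$ is *coherent* if $$P=\inf\{C\text{ copula}\mid P\le C\le Q\}\quad\text{and}\quad Q=\sup\{C\text{ copula}\mid P\le C\le Q\},$$ where the set is required to be nonempty. For a rectangle $R$ put $m_R(\mathbf x)=1$ if $\mathbf x\in\{\mathbf a,\mathbf c\}$, $m_R(\mathbf x)=-1$ if $\mathbf x\in\{\mathbf b,\mathbf d\}$, and $m_R(\mathbf x)=0$ otherwise. Let $\mathfrak R$ be the set of formal disjoint unions $R=\bigsqcup_{i=1}^nR_i$ of finitely many rectangles in $\overline{\mathbb R}^2$ (overlaps and repetitions are allowed), with $m_R=\sum_i m_{R_i}$. For $A\le B$ define $$L^{(A,B)}(R)=\sum_{m_R(\mathbf y)>0}B(\mathbf y)m_R(\mathbf y)+\sum_{m_R(\mathbf y)<0}A(\mathbf y)m_R(\mathbf y),$$ $$P_M^{(A,B)}(\mathbf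 x)=\inf_{R\in\mathfrak R,\ m_R(\mathbf x)>0}\frac{L^{(A,B)}(R)}{m_R(\mathbf x)},\qquad P_O^{(A,B)}(\mathbf x)=\inf_{R\in\mathfrak R,\ m_R(\mathbf x)<0}\frac{L^{(A,B)}(R)}{-m_R(\mathbf x)},$$ where $\inf\emptyset=+\infty$. *Statement.* Let $F_X,F_Y$ be univariate distributions, and let $A\le B$ be quasi-distributions on $\overline{\mathbb R}^2$ which both have margins $F_X$ and $F_Y$. The following conditions are equivalent: 1. $B-A\le P_O^{(A,B)}$ and $B-A\le P_M^{(A,B)}$ on $\overline{\mathbb R}^2$. 2. The set $\mathcal D$ of all distributions $F$ with margins $F_X,F_Y$ and $A\le F\le B$ is nonempty, $A=\inf\mathcal D$ and $B=\sup\mathcal D$. 3. There is a coherent pair of quasi-copulas $P\le Q$ such that $A(x,y)=P(F_X(x),F_Y(y))$ and $B(x,y)=Q(F_X(x),F_Y(y))$ for all $x,y\in\overline{\mathbb R}$. Moreover, if $(P,Q)$ is any coherent pair of quasi-copulas and $F_X,F_Y$ are any univariate distributions, then $A=P(F_X,F_Y)$ and $B=Q(F_X,F_Y)$ are quasi-distributions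 with margins $F_X,F_Y$, $A\le B$, and $A,B$ satisfy all of the conditions 1, 2, 3. -/

import Mathlib

namespace ImpreciseSklar

/-! ### Rectangles and volumes -/

/-- A rectangle with sides parallel to the axes and four distinct vertices, given by its
south-west vertex `a` and its north-east vertex `c`. -/
structure Rect (α : Type*) [LinearOrder α] where
  a : α × α
  c : α × α
  fst_lt : a.1 < c.1
  snd_lt : a.2 < c.2

namespace Rect

variable {α : Type*} [LinearOrder α]

/-- The south-east vertex. -/
def b (R : Rect α) : α × α := (R.c.1, R.a.2)

/-- The north-west vertex. -/
def d (R : Rect α) : α × α := (R.a.1, R.c.2)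

/-- The volume `V_F(R) = F(a) + F(c) - F(b) - F(d)`. -/
def volume (F : α × α → ℝ) (R : Rect α) : ℝ := F R.a + F R.c - F R.b - F R.d

/-- The set of all points of the rectangle. -/
def points (R : Rect α) : Set (α × α) := Set.Icc R.a R.c

/-- The main corner set `M(R) = {a, c}`. -/
def mainCorners (R : Rect α) : Finset (α × α) := {R.a, R.c}

/-- The opposite corner set `O(R) = {b, d}`. -/
def oppCorners (R : Rect α) : Finset (α × α) := {R.b, R.d}

/-- The multiplicity `m_R(x)` of a point with respect to one rectangle. -/
def mult (R : Rect α) (x : α × α) : ℤ :=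
  if x ∈ R.mainCorners then 1 else if x ∈ R.oppCorners then -1 else 0

end Rect

/-! ### Distributions and quasi-distributions on the extended plane -/

/-- The boundary of the extended plane: the points with an infinite coordinate. -/
def boundary : Set (EReal × EReal) :=
  {x | x.1 = ⊥ ∨ x.1 = ⊤ ∨ x.2 = ⊥ ∨ x.2 = ⊤}

/-- Functions with values in `[0,1]` that vanish when a coordinate is `-∞` and equal `1` at
`(∞, ∞)`. -/
structure IsNormalized (F : EReal × EReal → ℝ) : Prop where
  mem_Icc : ∀ x, F x ∈ Set.Icc (0 : ℝ) 1
  bot_right : ∀ x, F (x, ⊥) = 0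
  bot_left : ∀ y, F (⊥, y) = 0
  top_top : F (⊤, ⊤) = 1

/-- Bivariate quasi-distributions: the volume of every rectangle that meets the boundary is
nonnegative. -/
structure IsQuasiDistribution (F : EReal × EReal → ℝ) : Prop extends IsNormalized F where
  volume_nonneg : ∀ R : Rect EReal, (R.points ∩ boundary).Nonempty → 0 ≤ R.volume F

/-- Bivariate distributions: the volume of every rectangle is nonnegative. -/
structure IsDistribution (F : EReal × EReal → ℝ) : Prop extends IsNormalized F where
  volume_nonneg : ∀ R : Rect EReal, 0 ≤ R.volume F

/-- Univariate distribution functions (no one-sided continuity is required, so that finitely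
additive probabilities are covered). -/
structure IsUnivariateDistribution (F : EReal → unitInterval) : Prop where
  mono : Monotone F
  bot : F ⊥ = 0
  top : F ⊤ = 1

/-- `F` has margins `FX` and `FY`. -/
def HasMargins (FX FY : EReal → unitInterval) (F : EReal × EReal → ℝ) : Prop :=
  (∀ x, F (x, ⊤) = FX x) ∧ ∀ y, F (⊤, y) = FY y

/-- All quasi-distributions with margins `FX` and `FY`. -/
def quasiDistributions (FX FY : EReal → unitInterval) : Set (EReal × EReal → ℝ) :=
  {F | IsQuasiDistribution F ∧ HasMargins FX FY F}

/-- All distributions with margins `FX` and `FY`. -/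
def distributions (FX FY : EReal → unitInterval) : Set (EReal × EReal → ℝ) :=
  {F | IsDistribution F ∧ HasMargins FX FY F}

/-- All distributions with margins `FX` and `FY` that lie pointwise between `A` and `B`. -/
def distributionsBetween (FX FY : EReal → unitInterval) (A B : EReal × EReal → ℝ) :
    Set (EReal × EReal → ℝ) :=
  {F | F ∈ distributions FX FY ∧ A ≤ F ∧ F ≤ B}

/-! ### Pointwise infimum and supremum of a set of functions

With `IsGLB` and `IsLUB` in `ℝ` these can only hold for a nonempty set (over a nonempty domain). -/

/-- `f` is the pointwise infimum of the set `S` of functions. -/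
def IsPointwiseInf {X : Type*} (S : Set (X → ℝ)) (f : X → ℝ) : Prop :=
  ∀ x, IsGLB ((fun F : X → ℝ => F x) '' S) (f x)

/-- `f` is the pointwise supremum of the set `S` of functions. -/
def IsPointwiseSup {X : Type*} (S : Set (X → ℝ)) (f : X → ℝ) : Prop :=
  ∀ x, IsLUB ((fun F : X → ℝ => F x) '' S) (f x)

/-! ### Formal disjoint unions of rectangles and the functions `L`, `P_M`, `P_O` -/

/-- The formal disjoint unions of finitely many rectangles: a finite family, where rectangles may
overlap and be repeated. -/
abbrev RectUnion : Type := Multiset (Rect EReal)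

namespace RectUnion

/-- The multiplicity `m_R(x) = ∑ᵢ m_{Rᵢ}(x)`. -/
noncomputable def mult (R : RectUnion) (x : EReal × EReal) : ℤ :=
  (Multiset.map (fun S : Rect EReal => S.mult x) R).sum

/-- The finite set of all vertices of the rectangles in the family. -/
noncomputable def vertices (R : RectUnion) : Finset (EReal × EReal) :=
  (Multiset.map (fun S : Rect EReal => S.mainCorners ∪ S.oppCorners) R).sup

/-- Points that are no vertices have multiplicity zero, so that sums over the vertices are sums
over the whole extended plane. -/
theorem mult_eq_zero_of_notMem_vertices (R : RectUnion) (x : EReal × EReal)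
    (hx : x ∉ R.vertices) : R.mult x = 0 := by
  induction R using Multiset.induction_on with
  | empty => rfl
  | cons S R ih =>
    have h : x ∉ (S.mainCorners ∪ S.oppCorners) ∪ RectUnion.vertices R := by
      simpa [vertices] using hx
    rw [Finset.mem_union, not_or, Finset.mem_union, not_or] at h
    have h2 := ih h.2
    unfold mult at h2 ⊢
    rw [Multiset.map_cons, Multiset.sum_cons, h2]
    simp [Rect.mult, h.1.1, h.1.2]

/-- `L^{(A,B)}(R)`: the sum of `B(y) m_R(y)` over the points with `m_R(y) > 0` plus the sum of
`A(y) m_R(y)` over the points with `m_R(y) < 0`. -/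
noncomputable def L (A B : EReal × EReal → ℝ) (R : RectUnion) : ℝ :=
  ∑ y ∈ R.vertices with 0 < R.mult y, B y * (R.mult y : ℝ) +
    ∑ y ∈ R.vertices with R.mult y < 0, A y * (R.mult y : ℝ)

end RectUnion

/-- `P_M^{(A,B)}(x)`, an extended real; the infimum of the empty set is `+∞`. -/
noncomputable def PM (A B : EReal × EReal → ℝ) (x : EReal × EReal) : EReal :=
  ⨅ (R : RectUnion) (_ : 0 < R.mult x), ((RectUnion.L A B R / (R.mult x : ℝ) : ℝ) : EReal)

/-- `P_O^{(A,B)}(x)`, an extended real; the infimum of the empty set is `+∞`. -/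
noncomputable def PO (A B : EReal × EReal → ℝ) (x : EReal × EReal) : EReal :=
  ⨅ (R : RectUnion) (_ : R.mult x < 0), ((RectUnion.L A B R / (-(R.mult x : ℝ)) : ℝ) : EReal)

/-! ### Copulas and quasi-copulas -/

/-- Functions from the unit square to `[0,1]` that are grounded and have `1` as neutral element. -/
structure HasCopulaBoundary (C : unitInterval × unitInterval → ℝ) : Prop where
  mem_Icc : ∀ u, C u ∈ Set.Icc (0 : ℝ) 1
  zero_right : ∀ u, C (u, 0) = 0
  zero_left : ∀ v, C (0, v) = 0
  one_right : ∀ u : unitInterval, C (u, 1) = u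
  one_left : ∀ v : unitInterval, C (1, v) = v

/-- Bivariate copulas. -/
structure IsCopula (C : unitInterval × unitInterval → ℝ) : Prop extends HasCopulaBoundary C where
  volume_nonneg : ∀ R : Rect unitInterval, 0 ≤ R.volume C

/-- Bivariate quasi-copulas: increasing in each variable and 1-Lipschitz for the `ℓ¹` distance. -/
structure IsQuasiCopula (C : unitInterval × unitInterval → ℝ) : Prop
    extends HasCopulaBoundary C where
  mono_left : ∀ u u' v : unitInterval, u ≤ u' → C (u, v) ≤ C (u', v)
  mono_right : ∀ u v v' : unitInterval, v ≤ v' → C (u, v) ≤ C (u, v')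
  lipschitz : ∀ u u' v v' : unitInterval,
    |C (u, v) - C (u', v')| ≤ |(u : ℝ) - u'| + |(v : ℝ) - v'|

/-- All copulas that lie pointwise between `P` and `Q`. -/
def copulasBetween (P Q : unitInterval × unitInterval → ℝ) :
    Set (unitInterval × unitInterval → ℝ) :=
  {C | IsCopula C ∧ P ≤ C ∧ C ≤ Q}

/-- A coherent pair of quasi-copulas: `P ≤ Q` are the pointwise infimum and supremum of the copulas
between them. -/
structure IsCoherentPair (P Q : unitInterval × unitInterval → ℝ) : Prop where
  quasi_left : IsQuasiCopula P
  quasi_right : IsQuasiCopula Q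
  le : P ≤ Q
  eq_inf : IsPointwiseInf (copulasBetween P Q) P
  eq_sup : IsPointwiseSup (copulasBetween P Q) Q

/-- The composition `(x, y) ↦ C (FX x, FY y)`. -/
def compose (C : unitInterval × unitInterval → ℝ) (FX FY : EReal → unitInterval) :
    EReal × EReal → ℝ :=
  fun x => C (FX x.1, FY x.2)

/-! ### The three conditions -/

/-- `B - A ≤ P_O^{(A,B)}` and `B - A ≤ P_M^{(A,B)}` pointwise. -/
def VolumeCondition (A B : EReal × EReal → ℝ) : Prop :=
  (∀ x, ((B x - A x : ℝ) : EReal) ≤ PO A B x) ∧ ∀ x, ((B x - A x : ℝ) : EReal) ≤ PM A B x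

/-- `A` and `B` are the pointwise infimum and supremum of the distributions with margins `FX`, `FY`
between them. -/
def EnvelopeCondition (FX FY : EReal → unitInterval) (A B : EReal × EReal → ℝ) : Prop :=
  IsPointwiseInf (distributionsBetween FX FY A B) A ∧
    IsPointwiseSup (distributionsBetween FX FY A B) B

/-- `A = P(FX, FY)` and `B = Q(FX, FY)` for a coherent pair `P ≤ Q` of quasi-copulas. -/
def CopulaCondition (FX FY : EReal → unitInterval) (A B : EReal × EReal → ℝ) : Prop :=
  ∃ P Q : unitInterval × unitInterval → ℝ,
    IsCoherentPair P Q ∧ A = compose P FX FY ∧ B = compose Q FX FY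

end ImpreciseSklar

/-! Conditions 1 and 2 are dual to each other. A function `F` with `A ≤ F ≤ B` and nonnegative
volumes solves a system of linear inequalities with integer coefficients, one unknown per point. A
formal union `R` adds up some of them to `∑ F y * m_R(y) ≥ 0`, and `L(R)` is the largest value of
this sum over all `F` between `A` and `B`. So `L(R) ≥ 0` for all `R` is necessary for solvability;
it is also sufficient, by Fourier–Motzkin elimination of one coordinate and Zorn's lemma
(`exists_between_nonneg`). Prescribing `F x = A x` lowers `L(R)` by `(B x - A x) * m_R(x)` if
`m_R(x) > 0` and leaves it unchanged otherwise. Hence the bound by `P_M` keeps the system solvable,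
and the bound by `P_O` does the same for `F x = B x`. Both envelopes are then attained at each
point, and the margins are automatic because `A` and `B` share them.

Conditions 2 and 3 are linked by Sklar's theorem without continuity (`exists_copula`): one variable
at a time, a distribution is a function of its margin and extends over the gaps of the margin's
range by one-sided limits and affine interpolation. The infimum and supremum of all copulas that
compose to an admissible distribution form the required coherent pair. Conversely, composing the
copulas between `P` and `Q` with the margins gives enough distributions to attain the envelopes. -/

namespace ImpreciseSklar

/-! ### A sandwich theorem for systems of integer linear inequalities -/

section Sandwich

variable {X : Type*}

/-- The largest value of `∑ F y * w y` over the functions `F` between `A` and `B`. -/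
noncomputable def upperSum (A B : X → ℝ) (w : X →₀ ℤ) : ℝ :=
  w.sum fun y k => max (A y * k) (B y * k)

theorem upperSum_eq_sum (A B : X → ℝ) (w : X →₀ ℤ) {s : Finset X} (hs : w.support ⊆ s) :
    upperSum A B w = ∑ y ∈ s, max (A y * w y) (B y * w y) :=
  Finsupp.sum_of_support_subset _ hs _ (by simp)

/-- A maximum of sums is at most the sum of the maxima. Together with homogeneity this allows two
inequalities to be combined so that a coordinate cancels. -/
theorem upperSum_add_le (A B : X → ℝ) (v w : X →₀ ℤ) :
    upperSum A B (v + w) ≤ upperSum A B v + upperSum A B w := by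
  classical
  rw [upperSum_eq_sum A B (v + w) Finsupp.support_add,
    upperSum_eq_sum A B v Finset.subset_union_left,
    upperSum_eq_sum A B w Finset.subset_union_right, ← Finset.sum_add_distrib]
  refine Finset.sum_le_sum fun y _ => ?_
  rw [Finsupp.add_apply, Int.cast_add, mul_add, mul_add]
  exact max_add_add_le_max_add_max

theorem upperSum_nsmul (A B : X → ℝ) (n : ℕ) (w : X →₀ ℤ) :
    upperSum A B (n • w) = n * upperSum A B w := by
  rw [upperSum_eq_sum A B (n • w) Finsupp.support_smul,
    upperSum_eq_sum A B w subset_rfl, Finset.mul_sum]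
  refine Finset.sum_congr rfl fun y _ => ?_
  rw [mul_max_of_nonneg _ _ n.cast_nonneg, Finsupp.smul_apply]
  push_cast [nsmul_eq_mul]
  congr 1 <;> ring

/-- Isolates the term at `x`: with both bounds set to `0` there, the remainder does not depend on
the interval allowed at `x`. -/
theorem upperSum_update [DecidableEq X] (A B : X → ℝ) (x : X) (a b : ℝ) (w : X →₀ ℤ) :
    upperSum (Function.update A x a) (Function.update B x b) w =
      upperSum (Function.update A x 0) (Function.update B x 0) w
        + max (a * w x) (b * w x) := by
  rw [upperSum_eq_sum _ _ w (Finset.subset_insert x _),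
    upperSum_eq_sum _ _ w (Finset.subset_insert x _),
    ← Finset.add_sum_erase _ _ (Finset.mem_insert_self x _),
    ← Finset.add_sum_erase _ _ (Finset.mem_insert_self x _)]
  simp only [Function.update_self, zero_mul, max_self, zero_add]
  rw [add_comm]
  congr 1
  refine Finset.sum_congr rfl fun y hy => ?_
  simp [Function.update_of_ne (Finset.ne_of_mem_erase hy)]

theorem upperSum_eq_update [DecidableEq X] (A B : X → ℝ) (x : X) (w : X →₀ ℤ) :
    upperSum A B w = upperSum (Function.update A x 0) (Function.update B x 0) w
        + max (A x * w x) (B x * w x) := by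
  simpa using upperSum_update A B x (A x) (B x) w

/-- One interval of a feasible system can be shrunk to a point. -/
theorem exists_update_nonneg [DecidableEq X] (M : AddSubmonoid (X →₀ ℤ)) {A B : X → ℝ}
    (hAB : A ≤ B) (h : ∀ w ∈ M, 0 ≤ upperSum A B w) (x : X) :
    ∃ t, A x ≤ t ∧ t ≤ B x ∧
      ∀ w ∈ M, 0 ≤ upperSum (Function.update A x t) (Function.update B x t) w := by
  set r : (X →₀ ℤ) → ℝ := upperSum (Function.update A x 0) (Function.update B x 0) with hr
  have hx := hAB x
  have hpos : ∀ w ∈ M, 0 < w x → 0 ≤ r w + B x * w x := fun w hw hk => by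
    have hk' : (0 : ℝ) < w x := by exact_mod_cast hk
    have := h w hw
    rwa [upperSum_eq_update A B x, max_eq_right (by gcongr)] at this
  have hneg : ∀ w ∈ M, w x < 0 → 0 ≤ r w + A x * w x := fun w hw hk => by
    have hk' : (w x : ℝ) < 0 := by exact_mod_cast hk
    have := h w hw
    rwa [upperSum_eq_update A B x, max_eq_left (by nlinarith)] at this
  have hcross : ∀ v ∈ M, ∀ w ∈ M, 0 < v x → w x < 0 →
      -r v / v x ≤ r w / -(w x : ℝ) := fun v hv w hw hk hl => by
    have hk' : (0 : ℝ) < v x := by exact_mod_cast hk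
    have hl' : (0 : ℝ) < -(w x : ℝ) := by
      rw [neg_pos]
      exact_mod_cast hl
    -- Elimination of `x`: with `k = v x` and `l = -w x`, the combination `l • v + k • w` vanishes
    -- at `x`, and its inequality compares a lower bound for the value at `x` with an upper one.
    obtain ⟨k, hk2⟩ := Int.eq_ofNat_of_zero_le hk.le
    obtain ⟨l, hl2⟩ := Int.eq_ofNat_of_zero_le (neg_nonneg.2 hl.le)
    have h0 := h _ (M.add_mem (M.nsmul_mem hv l) (M.nsmul_mem hw k))
    have hz : (l • v + k • w) x = 0 := by
      simp only [Finsupp.add_apply, Finsupp.smul_apply, nsmul_eq_mul]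
      linear_combination -(w x) * hk2 - (v x) * hl2
    rw [upperSum_eq_update A B x, hz] at h0
    have h1 := upperSum_add_le (Function.update A x 0) (Function.update B x 0) (l • v) (k • w)
    rw [upperSum_nsmul, upperSum_nsmul] at h1
    have hkr : (k : ℝ) = v x := by rw [hk2]; simp
    have hlr : (l : ℝ) = -(w x : ℝ) := by rw [← Int.cast_neg, hl2]; simp
    rw [hkr, hlr] at h1
    simp only [Int.cast_zero, mul_zero, max_self, add_zero] at h0
    rw [div_le_div_iff₀ hk' hl']
    linarith
  -- All lower bounds on the value at `x`; each lies below each upper bound, so `sSup S` is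
  -- admissible. Inserting `A x` makes `S` nonempty.
  set S : Set ℝ := insert (A x) {s | ∃ v ∈ M, 0 < v x ∧ s = -r v / v x} with hS
  have hSB : ∀ s ∈ S, s ≤ B x := by
    rintro s (rfl | ⟨v, hv, hk, rfl⟩)
    · exact hx
    · have hk' : (0 : ℝ) < v x := by exact_mod_cast hk
      rw [div_le_iff₀ hk']
      linarith [hpos v hv hk]
  have hSw : ∀ w ∈ M, w x < 0 → ∀ s ∈ S, s ≤ r w / -(w x : ℝ) := by
    rintro w hw hl s (rfl | ⟨v, hv, hk, rfl⟩)
    · have hl' : (0 : ℝ) < -(w x : ℝ) := by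
        rw [neg_pos]
        exact_mod_cast hl
      rw [le_div_iff₀ hl']
      linarith [hneg w hw hl]
    · exact hcross v hv w hw hk hl
  have hne : S.Nonempty := ⟨A x, Set.mem_insert _ _⟩
  have hbdd : BddAbove S := ⟨B x, hSB⟩
  refine ⟨sSup S, le_csSup hbdd (Set.mem_insert _ _), csSup_le hne hSB, fun w hw => ?_⟩
  rw [upperSum_update, max_self]
  rcases lt_trichotomy (w x) 0 with hl | hz | hk
  · have hl' : (0 : ℝ) < -(w x : ℝ) := by
      rw [neg_pos]
      exact_mod_cast hl
    have := csSup_le hne (hSw w hw hl)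
    rw [le_div_iff₀ hl'] at this
    linarith
  · have := h w hw
    rw [upperSum_eq_update A B x] at this
    simpa [hz] using this
  · have hk' : (0 : ℝ) < w x := by exact_mod_cast hk
    have := le_csSup hbdd (Set.mem_insert_of_mem (A x) ⟨w, hw, hk, rfl⟩)
    rw [div_le_iff₀ hk'] at this
    linarith

/-- If no integer combination from `M` refutes the existence of a function between `A` and `B` on
which all elements of `M` are nonnegative, then there is such a function. -/
theorem exists_between_nonneg (M : AddSubmonoid (X →₀ ℤ)) {A B : X → ℝ}
    (hAB : A ≤ B) (h : ∀ w ∈ M, 0 ≤ upperSum A B w) :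
    ∃ F, A ≤ F ∧ F ≤ B ∧ ∀ w ∈ M, 0 ≤ w.sum fun y k => F y * k := by
  classical
  -- The order dual makes narrower pairs of bounds larger, so a maximal feasible pair leaves no room
  -- between its bounds.
  let S : Set ((X → ℝ) × (X → ℝ)ᵒᵈ) :=
    {p | p.1 ≤ OrderDual.ofDual p.2 ∧ ∀ w ∈ M, 0 ≤ upperSum p.1 (OrderDual.ofDual p.2) w}
  obtain ⟨p, hp, hmax⟩ := zorn_le_nonempty₀ S (by
    intro c hcS hc q hq
    have : Nonempty c := ⟨⟨q, hq⟩⟩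
    have hdir : IsDirectedOrder c := ⟨fun a b => (hc.total a.2 b.2).elim
      (fun hab => ⟨b, hab, le_rfl⟩) (fun hba => ⟨a, le_rfl, hba⟩)⟩
    have hle : ∀ (a b : c) y, a.1.1 y ≤ OrderDual.ofDual b.1.2 y := fun a b y => by
      obtain ⟨d, had, hbd⟩ := exists_ge_ge a b
      exact (had.1 y).trans ((hcS d.2).1 y |>.trans (hbd.2 y))
    have hb1 : ∀ y, BddAbove (Set.range fun a : c => a.1.1 y) := fun y =>
      ⟨OrderDual.ofDual q.2 y, by rintro _ ⟨a, rfl⟩; exact hle a ⟨q, hq⟩ y⟩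
    have hb2 : ∀ y, BddBelow (Set.range fun a : c => OrderDual.ofDual a.1.2 y) := fun y =>
      ⟨q.1 y, by rintro _ ⟨a, rfl⟩; exact hle ⟨q, hq⟩ a y⟩
    refine ⟨(fun y => ⨆ a : c, a.1.1 y,
      OrderDual.toDual fun y => ⨅ a : c, OrderDual.ofDual a.1.2 y), ⟨?_, ?_⟩, ?_⟩
    · exact fun y => ciSup_le fun a => le_ciInf fun b => hle a b y
    · intro w hw
      -- Since `w` has finite support, its inequality involves finitely many bounds and survives the
      -- limit along the chain.
      have ht : Filter.Tendsto (fun a : c => upperSum a.1.1 (OrderDual.ofDual a.1.2) w)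
          Filter.atTop (nhds (upperSum (fun y => ⨆ a : c, a.1.1 y)
            (fun y => ⨅ a : c, OrderDual.ofDual a.1.2 y) w)) := by
        refine tendsto_finsetSum _ fun y _ => Filter.Tendsto.max ?_ ?_
        · exact (tendsto_atTop_ciSup (fun (a b : c) hab => (show a.1 ≤ b.1 from hab).1 y) (hb1 y)).mul_const _
        · exact (tendsto_atTop_ciInf (fun (a b : c) hab => (show a.1 ≤ b.1 from hab).2 y) (hb2 y)).mul_const _
      exact ge_of_tendsto' ht fun a => (hcS a.2).2 w hw
    · exact fun z hz => ⟨fun y => le_ciSup (hb1 y) ⟨z, hz⟩, fun y => ciInf_le (hb2 y) ⟨z, hz⟩⟩)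
    (A, OrderDual.toDual B) ⟨hAB, h⟩
  obtain ⟨hpS, hmax⟩ := hmax
  have heq : ∀ x, p.1 x = OrderDual.ofDual p.2 x := fun x => by
    obtain ⟨t, h1, h2, h3⟩ := exists_update_nonneg M hpS.1 hpS.2 x
    have := hmax (y := (Function.update p.1 x t,
        OrderDual.toDual (Function.update (OrderDual.ofDual p.2) x t))) ⟨?_, h3⟩ ⟨?_, ?_⟩
    · have e1 := this.1 x
      have e2 := this.2 x
      simp only [Function.update_self] at e1
      have e3 : OrderDual.ofDual p.2 x ≤ Function.update (OrderDual.ofDual p.2) x t x := e2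
      rw [Function.update_self] at e3
      exact le_antisymm (h1.trans h2) (e3.trans e1)
    · exact update_le_update_iff.2 ⟨le_rfl, fun y _ => hpS.1 y⟩
    · exact le_update_iff.2 ⟨h1, fun y _ => le_rfl⟩
    · exact update_le_iff.2 ⟨h2, fun y _ => le_rfl⟩
  refine ⟨p.1, hp.1, fun x => (heq x).trans_le (hp.2 x), fun w hw => ?_⟩
  have := hpS.2 w hw
  rw [← funext heq] at this
  simpa [upperSum] using this

end Sandwich

/-! ### Functions of two variables with nonnegative volumes -/

section TwoIncreasing

variable {α β : Type*} [LinearOrder α] [LinearOrder β]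

/-- All volumes of rectangles, degenerate ones included, are nonnegative. -/
def TwoIncreasing (G : α → β → ℝ) : Prop :=
  ∀ ⦃x x' y y'⦄, x ≤ x' → y ≤ y' → 0 ≤ G x y + G x' y' - G x' y - G x y'

theorem twoIncreasing_iff {F : α × α → ℝ} :
    TwoIncreasing (fun x y => F (x, y)) ↔ ∀ R : Rect α, 0 ≤ R.volume F := by
  constructor
  · exact fun h R => h R.fst_lt.le R.snd_lt.le
  · intro h x x' y y' hx hy
    rcases hx.eq_or_lt with rfl | hx
    · simp
    rcases hy.eq_or_lt with rfl | hy
    · simp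
    exact h ⟨(x, y), (x', y'), hx, hy⟩

theorem TwoIncreasing.swap {G : α → β → ℝ} (h : TwoIncreasing G) :
    TwoIncreasing fun y x => G x y := fun y y' x x' hy hx => by linarith [h hx hy]

theorem TwoIncreasing.comp {γ δ : Type*} [LinearOrder γ] [LinearOrder δ] {G : α → β → ℝ}
    (h : TwoIncreasing G) {f : γ → α} {g : δ → β} (hf : Monotone f) (hg : Monotone g) :
    TwoIncreasing fun x y => G (f x) (g y) := fun _ _ _ _ hx hy => h (hf hx) (hg hy)

theorem TwoIncreasing.mono_left [OrderBot β] {G : α → β → ℝ} (h : TwoIncreasing G)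
    (h0 : ∀ x, G x ⊥ = 0) (y : β) : Monotone fun x => G x y := fun x x' hx => by
  have := h hx (bot_le : ⊥ ≤ y)
  rw [h0, h0] at this
  simp only
  linarith

/-- Increments in the first variable grow with the second, so the margin has the largest ones. This
is the source of the Lipschitz bound for copulas. -/
theorem TwoIncreasing.sub_le [OrderTop β] {G : α → β → ℝ} (h : TwoIncreasing G)
    {x x' : α} (hx : x ≤ x') (y : β) : G x' y - G x y ≤ G x' ⊤ - G x ⊤ := by
  linarith [h hx (le_top : y ≤ ⊤)]

end TwoIncreasing

/-! ### Interpolation along a monotone function -/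

section Interpolation

variable {α : Type*} [LinearOrder α] [BoundedOrder α]

/-- The left limit at `u` of `h`, seen as a function of `f`. -/
noncomputable def lowerLim (f : α → unitInterval) (h : α → ℝ) (u : unitInterval) : ℝ :=
  ⨆ x : {x // f x ≤ u}, h x

/-- The right limit at `u` of `h`, seen as a function of `f`. -/
noncomputable def upperLim (f : α → unitInterval) (h : α → ℝ) (u : unitInterval) : ℝ :=
  ⨅ x : {x // u ≤ f x}, h x

/-- The position of `u` in the gap of the range of `f` that contains it. -/
noncomputable def gapWeight (f : α → unitInterval) (u : unitInterval) : ℝ :=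
  (u - lowerLim f (fun x => f x) u) / (upperLim f (fun x => f x) u - lowerLim f (fun x => f x) u)

/-- `h`, seen as a function of `f`, is extended to the unit interval by affine interpolation. -/
noncomputable def interpolate (f : α → unitInterval) (h : α → ℝ) (u : unitInterval) : ℝ :=
  lowerLim f h u + gapWeight f u * (upperLim f h u - lowerLim f h u)

/-- `h` is an increasing function of `f`. -/
def IncreasingIn {α : Type*} (f : α → unitInterval) (h : α → ℝ) : Prop := ∀ ⦃x x'⦄, f x ≤ f x' → h x ≤ h x'

variable {f : α → unitInterval} {h k : α → ℝ} {u u' : unitInterval}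

theorem increasingIn_self {α : Type*} {f : α → unitInterval} : IncreasingIn f fun x => (f x : ℝ) := fun _ _ hx => hx

theorem nonempty_le (h0 : f ⊥ = 0) (u : unitInterval) : Nonempty {x // f x ≤ u} :=
  ⟨⟨⊥, h0.trans_le u.2.1⟩⟩

theorem nonempty_ge (h1 : f ⊤ = 1) (u : unitInterval) : Nonempty {x // u ≤ f x} :=
  ⟨⟨⊤, h1.ge.trans' u.2.2⟩⟩

theorem IncreasingIn.bddAbove (h1 : f ⊤ = 1) (hh : IncreasingIn f h) :
    BddAbove (Set.range fun x : {x // f x ≤ u} => h x) :=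
  ⟨h ⊤, by rintro _ ⟨x, rfl⟩; exact hh (h1.ge.trans' (f x).2.2)⟩

theorem IncreasingIn.bddBelow (h0 : f ⊥ = 0) (hh : IncreasingIn f h) :
    BddBelow (Set.range fun x : {x // u ≤ f x} => h x) :=
  ⟨h ⊥, by rintro _ ⟨x, rfl⟩; exact hh (h0.trans_le (f x).2.1)⟩

theorem IncreasingIn.tendsto_lowerLim (hf : Monotone f) (h1 : f ⊤ = 1) (hh : IncreasingIn f h) :
    Filter.Tendsto (fun x : {x // f x ≤ u} => h x) Filter.atTop (nhds (lowerLim f h u)) :=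
  tendsto_atTop_ciSup (fun _ _ hx => hh (hf hx)) (hh.bddAbove h1)

theorem IncreasingIn.tendsto_upperLim (hf : Monotone f) (h0 : f ⊥ = 0) (hh : IncreasingIn f h) :
    Filter.Tendsto (fun x : {x // u ≤ f x} => h x) Filter.atBot (nhds (upperLim f h u)) :=
  tendsto_atBot_ciInf (fun _ _ hx => hh (hf hx)) (hh.bddBelow h0)

theorem IncreasingIn.le_lowerLim (h1 : f ⊤ = 1) (hh : IncreasingIn f h) {x : α} (hx : f x ≤ u) :
    h x ≤ lowerLim f h u :=
  le_ciSup (f := fun x : {x // f x ≤ u} => h x) (hh.bddAbove h1) ⟨x, hx⟩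

theorem IncreasingIn.upperLim_le (h0 : f ⊥ = 0) (hh : IncreasingIn f h) {x : α} (hx : u ≤ f x) :
    upperLim f h u ≤ h x :=
  ciInf_le (f := fun x : {x // u ≤ f x} => h x) (hh.bddBelow h0) ⟨x, hx⟩

theorem IncreasingIn.lowerLim_le_upperLim (h0 : f ⊥ = 0) (h1 : f ⊤ = 1) (hh : IncreasingIn f h) :
    lowerLim f h u ≤ upperLim f h u :=
  have := nonempty_le h0 u
  have := nonempty_ge h1 u
  ciSup_le fun x => le_ciInf fun y => hh (x.2.trans y.2)

theorem lowerLim_self_le (h0 : f ⊥ = 0) : lowerLim f (fun x => f x) u ≤ u :=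
  have := nonempty_le h0 u
  ciSup_le fun x => x.2

theorem le_upperLim_self (h1 : f ⊤ = 1) : u ≤ upperLim f (fun x => f x) u :=
  have := nonempty_ge h1 u
  le_ciInf fun x => x.2

theorem gapWeight_nonneg (h0 : f ⊥ = 0) (h1 : f ⊤ = 1) : 0 ≤ gapWeight f u :=
  div_nonneg (sub_nonneg.2 (lowerLim_self_le h0))
    (sub_nonneg.2 (increasingIn_self.lowerLim_le_upperLim h0 h1))

theorem gapWeight_le_one (h0 : f ⊥ = 0) (h1 : f ⊤ = 1) : gapWeight f u ≤ 1 :=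
  div_le_one_of_le₀ (sub_le_sub_right (le_upperLim_self h1) _)
    (sub_nonneg.2 (increasingIn_self.lowerLim_le_upperLim h0 h1))

theorem interpolate_self (h0 : f ⊥ = 0) (h1 : f ⊤ = 1) :
    interpolate f (fun x => f x) u = u := by
  have ha := lowerLim_self_le (u := u) h0
  have hb := le_upperLim_self (u := u) h1
  unfold interpolate gapWeight
  -- If the gap has length zero, the weight is multiplied by `0`, and the common limit is squeezed
  -- to `u`.
  rcases (ha.trans hb).eq_or_lt with he | hlt
  · rw [← he]
    simp only [sub_self, mul_zero, add_zero]
    exact le_antisymm ha (he ▸ hb)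
  · rw [div_mul_cancel₀ _ (sub_pos.2 hlt).ne']
    ring

theorem IncreasingIn.interpolate_apply (h0 : f ⊥ = 0) (h1 : f ⊤ = 1) (hh : IncreasingIn f h)
    (x : α) : interpolate f h (f x) = h x := by
  have := nonempty_le h0 (f x)
  have := nonempty_ge h1 (f x)
  have hl : lowerLim f h (f x) = h x :=
    le_antisymm (ciSup_le fun y => hh y.2) (hh.le_lowerLim h1 le_rfl)
  have hu : upperLim f h (f x) = h x :=
    le_antisymm (hh.upperLim_le h0 le_rfl) (le_ciInf fun y => hh y.2)
  simp [interpolate, hl, hu]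

theorem interpolate_zero (h0 : f ⊥ = 0) (h1 : f ⊤ = 1) : interpolate f (fun _ => 0) u = 0 := by
  have := nonempty_le h0 u
  have := nonempty_ge h1 u
  simp [interpolate, lowerLim, upperLim]

/-- Suprema and infima are not additive in general, but here they are limits of monotone nets, and
the weight depends only on `f` and `u`. -/
theorem IncreasingIn.interpolate_sub (hf : Monotone f) (h0 : f ⊥ = 0) (h1 : f ⊤ = 1)
    (hh : IncreasingIn f h) (hk : IncreasingIn f k) (hhk : IncreasingIn f (h - k)) :
    interpolate f (h - k) u = interpolate f h u - interpolate f k u := by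
  have := nonempty_le h0 u
  have := nonempty_ge h1 u
  have hl : lowerLim f (h - k) u = lowerLim f h u - lowerLim f k u :=
    tendsto_nhds_unique (hhk.tendsto_lowerLim hf h1)
      ((hh.tendsto_lowerLim hf h1).sub (hk.tendsto_lowerLim hf h1))
  have hu : upperLim f (h - k) u = upperLim f h u - upperLim f k u :=
    tendsto_nhds_unique (hhk.tendsto_upperLim hf h0)
      ((hh.tendsto_upperLim hf h0).sub (hk.tendsto_upperLim hf h0))
  unfold interpolate
  rw [hl, hu]
  ring

theorem IncreasingIn.monotone_interpolate (h0 : f ⊥ = 0) (h1 : f ⊤ = 1)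
    (hh : IncreasingIn f h) : Monotone (interpolate f h) := by
  intro u u' huu
  have hd : 0 ≤ upperLim f h u - lowerLim f h u := sub_nonneg.2 (hh.lowerLim_le_upperLim h0 h1)
  -- A value `f x` between `u` and `u'` separates the interpolated values by `h x`. Otherwise both
  -- points lie in the same gap, so the limits agree and only the weight grows.
  by_cases hx : ∃ x, u ≤ f x ∧ f x ≤ u'
  · obtain ⟨x, hx, hx'⟩ := hx
    have e1 : interpolate f h u ≤ upperLim f h u := by
      have := mul_le_mul_of_nonneg_right (gapWeight_le_one (u := u) h0 h1) hd
      unfold interpolate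
      linarith
    have e2 : lowerLim f h u' ≤ interpolate f h u' :=
      le_add_of_nonneg_right (mul_nonneg (gapWeight_nonneg h0 h1)
        (sub_nonneg.2 (hh.lowerLim_le_upperLim h0 h1)))
    exact (e1.trans (hh.upperLim_le h0 hx)).trans ((hh.le_lowerLim h1 hx').trans e2)
  · push Not at hx
    have hle : (fun x => f x ≤ u') = fun x => f x ≤ u := funext fun x => propext
      ⟨fun hx' => le_of_not_ge fun hx2 => (hx x hx2).not_ge hx', fun hx' => hx'.trans huu⟩
    have hge : (fun x => u' ≤ f x) = fun x => u ≤ f x := funext fun x => propext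
      ⟨fun hx' => huu.trans hx', fun hx' => (hx x hx').le⟩
    have hl : ∀ k : α → ℝ, lowerLim f k u' = lowerLim f k u := fun k =>
      congrArg (fun p : α → Prop => ⨆ x : {x // p x}, k x) hle
    have hu : ∀ k : α → ℝ, upperLim f k u' = upperLim f k u := fun k =>
      congrArg (fun p : α → Prop => ⨅ x : {x // p x}, k x) hge
    have hw : gapWeight f u ≤ gapWeight f u' := by
      unfold gapWeight
      rw [hl, hu]
      exact div_le_div_of_nonneg_right (sub_le_sub_right (show (u : ℝ) ≤ u' from huu) _)
        (sub_nonneg.2 (increasingIn_self.lowerLim_le_upperLim h0 h1))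
    unfold interpolate
    rw [hl, hu]
    have := mul_le_mul_of_nonneg_right hw hd
    linarith

/-- A two-increasing function can be written as a function of its margin in the first variable. -/
theorem TwoIncreasing.exists_extension {β : Type*} [LinearOrder β] [BoundedOrder β]
    {G : α → β → ℝ} (hG : TwoIncreasing G) (hGbot : ∀ x, G x ⊥ = 0)
    (hf : Monotone f) (h0 : f ⊥ = 0) (h1 : f ⊤ = 1) (hGtop : ∀ x, G x ⊤ = f x) :
    ∃ H : unitInterval → β → ℝ, TwoIncreasing H ∧ (∀ u, H u ⊥ = 0) ∧ (∀ u, H u ⊤ = u) ∧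
      ∀ x y, H (f x) y = G x y := by
  have hinc : ∀ ⦃y y'⦄, y ≤ y' → IncreasingIn f fun x => G x y' - G x y := by
    intro y y' hy x x' hx
    rcases le_total x x' with hxx | hxx
    · have := hG hxx hy
      simp only
      linarith
    · have e : f x = f x' := le_antisymm hx (hf hxx)
      have e1 := hG hxx (le_top : y' ≤ ⊤)
      have e2 := hG hxx (bot_le : ⊥ ≤ y)
      rw [hGtop, hGtop, e] at e1
      rw [hGbot, hGbot] at e2
      simp only
      linarith
  have hinc0 : ∀ y, IncreasingIn f fun x => G x y := fun y => by
    simpa [hGbot] using hinc (bot_le : ⊥ ≤ y)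
  refine ⟨fun u y => interpolate f (fun x => G x y) u, ?_, fun u => ?_, fun u => ?_,
    fun x y => (hinc0 y).interpolate_apply h0 h1 x⟩
  · intro u u' y y' hu hy
    -- The increment of the extension from `y` to `y'` is the interpolated increment of `G`, which
    -- is increasing in `u`.
    have := (hinc hy).monotone_interpolate h0 h1 hu
    have e : ∀ v, interpolate f (fun x => G x y' - G x y) v =
        interpolate f (fun x => G x y') v - interpolate f (fun x => G x y) v := fun v =>
      IncreasingIn.interpolate_sub hf h0 h1 (hinc0 y') (hinc0 y) (hinc hy)
    rw [e, e] at this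
    linarith
  · simp only [hGbot]
    exact interpolate_zero h0 h1
  · simp only [hGtop]
    exact interpolate_self h0 h1

end Interpolation


/-! ### Multiplicities of rectangles -/

/-- The four vertices are distinct, so the nested cases become a signed sum of indicators, which is
linear enough to be summed against `F`. -/
theorem Rect.mult_eq {α : Type*} [LinearOrder α] (R : Rect α) (x : α × α) :
    R.mult x = (if x = R.a then 1 else 0) + (if x = R.c then 1 else 0)
      - (if x = R.b then 1 else 0) - (if x = R.d then 1 else 0) := by
  have h1 := R.fst_lt.ne
  have h2 := R.snd_lt.ne
  have hab : R.a ≠ R.b := fun h => h1 (congrArg (fun p => p.1) h)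
  have had : R.a ≠ R.d := fun h => h2 (congrArg (fun p => p.2) h)
  have hcb : R.c ≠ R.b := fun h => h2 (congrArg Prod.snd h).symm
  have hcd : R.c ≠ R.d := fun h => h1 (congrArg Prod.fst h).symm
  have hac : R.a ≠ R.c := fun h => h1 (congrArg Prod.fst h)
  have hbd : R.b ≠ R.d := fun h => h2 (congrArg (fun p => p.2) h)
  simp only [Rect.mult, Rect.mainCorners, Rect.oppCorners, Finset.mem_insert,
    Finset.mem_singleton]
  by_cases ha : x = R.a
  · subst ha; simp [hab, had, hac]
  by_cases hc : x = R.c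
  · subst hc; simp [hcb, hcd, hac.symm]
  by_cases hb : x = R.b
  · subst hb; simp [hab.symm, hcb.symm, hbd]
  by_cases hd : x = R.d
  · subst hd; simp [had.symm, hcd.symm, hbd.symm]
  simp [ha, hc, hb, hd]

theorem Rect.sum_mul_mult {α : Type*} [LinearOrder α] (R : Rect α) (F : α × α → ℝ)
    {s : Finset (α × α)} (hs : R.mainCorners ∪ R.oppCorners ⊆ s) :
    ∑ y ∈ s, F y * (R.mult y : ℝ) = R.volume F := by
  have ha : R.a ∈ s := hs (by simp [Rect.mainCorners])
  have hc : R.c ∈ s := hs (by simp [Rect.mainCorners])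
  have hb : R.b ∈ s := hs (by simp [Rect.oppCorners])
  have hd : R.d ∈ s := hs (by simp [Rect.oppCorners])
  simp [Rect.mult_eq, mul_add, mul_sub, Finset.sum_add_distrib, Finset.sum_sub_distrib, ha, hb,
    hc, hd, Rect.volume]

namespace RectUnion

/-- The multiplicity as a finitely supported function. -/
noncomputable def weight (R : RectUnion) : EReal × EReal →₀ ℤ :=
  Finsupp.onFinset R.vertices R.mult fun x hx =>
    not_imp_comm.1 (R.mult_eq_zero_of_notMem_vertices x) hx

theorem weight_apply (R : RectUnion) (x : EReal × EReal) : R.weight x = R.mult x := rfl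

theorem weight_zero : weight (0 : RectUnion) = 0 := Finsupp.ext fun _ => rfl

theorem weight_add (R S : RectUnion) : weight (R + S : RectUnion) = R.weight + S.weight :=
  Finsupp.ext fun x => by
    rw [Finsupp.add_apply, weight_apply, weight_apply, weight_apply]
    simp [mult]

/-- The submonoid of all multiplicities. -/
noncomputable def weights : AddSubmonoid (EReal × EReal →₀ ℤ) where
  carrier := Set.range weight
  zero_mem' := ⟨0, weight_zero⟩
  add_mem' := by
    rintro _ _ ⟨R, rfl⟩ ⟨S, rfl⟩
    exact ⟨R + S, weight_add R S⟩

theorem support_weight_subset (R : RectUnion) : R.weight.support ⊆ R.vertices :=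
  Finsupp.support_onFinset_subset

theorem L_eq_upperSum {A B : EReal × EReal → ℝ} (hAB : A ≤ B) (R : RectUnion) :
    L A B R = upperSum A B R.weight := by
  rw [upperSum_eq_sum A B _ R.support_weight_subset, L, Finset.sum_filter, Finset.sum_filter,
    ← Finset.sum_add_distrib]
  refine Finset.sum_congr rfl fun y _ => ?_
  have := hAB y
  rw [weight_apply]
  rcases lt_trichotomy (R.mult y) 0 with h | h | h
  · have h' : (R.mult y : ℝ) < 0 := by exact_mod_cast h
    rw [if_neg h.not_gt, if_pos h, zero_add, max_eq_left (by nlinarith)]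
  · simp [h]
  · have h' : (0 : ℝ) < R.mult y := by exact_mod_cast h
    rw [if_pos h, if_neg h.not_gt, add_zero, max_eq_right (by gcongr)]

theorem sum_weight_eq (F : EReal × EReal → ℝ) (R : RectUnion) :
    (R.weight.sum fun y k => F y * k) = (R.map fun S => S.volume F).sum := by
  induction R using Multiset.induction_on with
  | empty => simp [weight_zero]
  | cons S R ih =>
    have h1 : (weight ({S} : RectUnion)).sum (fun y k => F y * (k : ℝ)) = S.volume F := by
      rw [Finsupp.sum_of_support_subset _ (support_weight_subset _) _ (by simp),
        ← S.sum_mul_mult F (s := vertices {S}) (by simp [vertices])]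
      simp [weight_apply, mult]
    rw [← Multiset.singleton_add, weight_add, Finsupp.sum_add_index' (by simp)
      (by intros; push_cast; ring), h1, ih]
    simp

theorem volume_nonneg_of_weights {F : EReal × EReal → ℝ}
    (h : ∀ w ∈ weights, 0 ≤ w.sum fun y k => F y * k) (S : Rect EReal) : 0 ≤ S.volume F := by
  have := h _ ⟨{S}, rfl⟩
  rwa [sum_weight_eq, Multiset.map_singleton, Multiset.sum_singleton] at this

/-- The difference between `upperSum` and the nonnegative sum `∑ F y * m_R(y)` is a sum of
nonnegative slacks, hence at least the slack at `x`. -/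
theorem add_le_upperSum {A B F : EReal × EReal → ℝ} (hF : ∀ S : Rect EReal, 0 ≤ S.volume F)
    (hA : A ≤ F) (hB : F ≤ B) (R : RectUnion) {x : EReal × EReal} (hx : R.mult x ≠ 0) :
    max (A x * R.mult x) (B x * R.mult x) - F x * R.mult x ≤ upperSum A B R.weight := by
  have h0 : 0 ≤ R.weight.sum fun y k => F y * k := by
    rw [sum_weight_eq]
    exact Multiset.sum_nonneg (by simpa using fun S _ => hF S)
  have hle : ∀ y ∈ R.weight.support, 0 ≤
      max (A y * R.weight y) (B y * R.weight y) - F y * R.weight y := fun y _ => by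
    rcases le_total (R.weight y : ℝ) 0 with h | h
    · exact sub_nonneg.2 (le_max_of_le_left (mul_le_mul_of_nonpos_right (hA y) h))
    · exact sub_nonneg.2 (le_max_of_le_right (mul_le_mul_of_nonneg_right (hB y) h))
  have h1 := Finset.single_le_sum hle (Finsupp.mem_support_iff.2 hx)
  rw [Finset.sum_sub_distrib] at h1
  have h2 : 0 ≤ ∑ y ∈ R.weight.support, F y * (R.weight y : ℝ) := h0
  rw [upperSum_eq_sum A B _ subset_rfl]
  simp only [weight_apply] at h1 h2 ⊢
  linarith

end RectUnion

/-! ### The volume condition and the envelope condition -/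

/-- Clearing denominators merges the two infima into one family of real inequalities; the absolute
value covers both signs. -/
theorem volumeCondition_iff {A B : EReal × EReal → ℝ} (hAB : A ≤ B) :
    VolumeCondition A B ↔ ∀ (R : RectUnion) (x : EReal × EReal), R.mult x ≠ 0 →
      (B x - A x) * |(R.mult x : ℝ)| ≤ upperSum A B R.weight := by
  simp only [VolumeCondition, PO, PM, le_iInf_iff, EReal.coe_le_coe_iff,
    RectUnion.L_eq_upperSum hAB]
  constructor
  · rintro ⟨hO, hM⟩ R x hx
    rcases lt_or_gt_of_ne hx with h | h
    · have h' : (R.mult x : ℝ) < 0 := by exact_mod_cast h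
      rw [abs_of_neg h', ← le_div_iff₀ (neg_pos.2 h')]
      exact hO x R h
    · have h' : (0 : ℝ) < R.mult x := by exact_mod_cast h
      rw [abs_of_pos h', ← le_div_iff₀ h']
      exact hM x R h
  · refine fun H => ⟨fun x R h => ?_, fun x R h => ?_⟩
    · have h' : (R.mult x : ℝ) < 0 := by exact_mod_cast h
      have := H R x h.ne
      rwa [abs_of_neg h', ← le_div_iff₀ (neg_pos.2 h')] at this
    · have h' : (0 : ℝ) < R.mult x := by exact_mod_cast h
      have := H R x h.ne'
      rwa [abs_of_pos h', ← le_div_iff₀ h'] at this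

/-- For positive multiplicity the slack at `x` is `(B x - F x) * m_R(x)`, and `F x` may be taken
down to its infimum `A x`; for negative multiplicity it is `(F x - A x) * |m_R(x)|`, and `F x` goes
up to `B x`. -/
theorem EnvelopeCondition.volumeCondition {FX FY : EReal → unitInterval}
    {A B : EReal × EReal → ℝ} (hAB : A ≤ B) (h : EnvelopeCondition FX FY A B) :
    VolumeCondition A B := by
  refine (volumeCondition_iff hAB).2 fun R x hx => ?_
  rcases lt_or_gt_of_ne hx with hm | hm
  · have hm' : (R.mult x : ℝ) < 0 := by exact_mod_cast hm
    rw [abs_of_neg hm', ← le_div_iff₀ (neg_pos.2 hm'), sub_le_iff_le_add]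
    refine (h.2 x).2 ?_
    rintro _ ⟨F, ⟨⟨hF, -⟩, hA, hB⟩, rfl⟩
    have := RectUnion.add_le_upperSum hF.volume_nonneg hA hB R hx
    simp only
    rw [← sub_le_iff_le_add, le_div_iff₀ (neg_pos.2 hm')]
    linarith [le_max_left (A x * R.mult x) (B x * R.mult x)]
  · have hm' : (0 : ℝ) < R.mult x := by exact_mod_cast hm
    rw [abs_of_pos hm', ← le_div_iff₀ hm', sub_le_comm]
    refine (h.1 x).2 ?_
    rintro _ ⟨F, ⟨⟨hF, -⟩, hA, hB⟩, rfl⟩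
    have := RectUnion.add_le_upperSum hF.volume_nonneg hA hB R hx
    simp only
    rw [sub_le_comm, le_div_iff₀ hm']
    linarith [le_max_right (A x * R.mult x) (B x * R.mult x)]

theorem VolumeCondition.upperSum_nonneg {A B : EReal × EReal → ℝ} (hAB : A ≤ B)
    (h : VolumeCondition A B) (R : RectUnion) : 0 ≤ upperSum A B R.weight := by
  by_cases h0 : R.weight = 0
  · simp [h0, upperSum]
  · obtain ⟨x, hx⟩ := Finsupp.ne_iff.1 h0
    exact (mul_nonneg (sub_nonneg.2 (hAB x)) (abs_nonneg _)).trans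
      ((volumeCondition_iff hAB).1 h R x hx)

/-- Where a coordinate is infinite, `A` and `B` coincide and pin `F` down, so only the volumes have
to be checked. -/
theorem mem_distributionsBetween {FX FY : EReal → unitInterval} {A B F : EReal × EReal → ℝ}
    (hA : A ∈ quasiDistributions FX FY) (hB : B ∈ quasiDistributions FX FY)
    (hAF : A ≤ F) (hFB : F ≤ B) (hF : ∀ S : Rect EReal, 0 ≤ S.volume F) :
    F ∈ distributionsBetween FX FY A B := by
  obtain ⟨hA, hAX, hAY⟩ := hA
  obtain ⟨hB, hBX, hBY⟩ := hB
  have sq : ∀ {x c}, A x = c → B x = c → F x = c := fun h1 h2 =>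
    le_antisymm ((hFB _).trans_eq h2) (h1.symm.trans_le (hAF _))
  exact ⟨⟨⟨⟨fun x => ⟨(hA.mem_Icc x).1.trans (hAF x), (hFB x).trans (hB.mem_Icc x).2⟩,
    fun x => sq (hA.bot_right x) (hB.bot_right x), fun y => sq (hA.bot_left y) (hB.bot_left y),
    sq hA.top_top hB.top_top⟩, hF⟩, fun x => sq (hAX x) (hBX x), fun y => sq (hAY y) (hBY y)⟩,
    hAF, hFB⟩

theorem VolumeCondition.envelopeCondition {FX FY : EReal → unitInterval}
    {A B : EReal × EReal → ℝ} (hA : A ∈ quasiDistributions FX FY)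
    (hB : B ∈ quasiDistributions FX FY) (hAB : A ≤ B) (h : VolumeCondition A B) :
    EnvelopeCondition FX FY A B := by
  have key : ∀ x t, A x ≤ t → t ≤ B x → (t = A x ∨ t = B x) →
      t ∈ (fun F : EReal × EReal → ℝ => F x) '' distributionsBetween FX FY A B := by
    intro x t hAt htB ht
    have hAt' : A ≤ Function.update A x t := le_update_iff.2 ⟨hAt, fun _ _ => le_rfl⟩
    have htB' : Function.update B x t ≤ B := update_le_iff.2 ⟨htB, fun _ _ => le_rfl⟩
    obtain ⟨F, hAF, hFB, hF⟩ := exists_between_nonneg RectUnion.weights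
      (A := Function.update A x t) (B := Function.update B x t)
      (update_le_update_iff.2 ⟨le_rfl, fun y _ => hAB y⟩) (by
        rintro _ ⟨R, rfl⟩
        have h0 := h.upperSum_nonneg hAB R
        rw [upperSum_update, max_self]
        rw [upperSum_eq_update A B x] at h0
        by_cases hx : R.mult x = 0
        · simpa [R.weight_apply, hx] using h0
        have h1 := (volumeCondition_iff hAB).1 h R x hx
        rw [upperSum_eq_update A B x] at h1
        have hABx := hAB x
        rw [R.weight_apply] at *
        -- Pinning the value at the endpoint that already realizes the maximum changes nothing
        -- (`h0`); at the other endpoint the loss is `(B x - A x) * |m_R(x)|`, which `h1` covers.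
        rcases le_total (R.mult x : ℝ) 0 with hm | hm
        · rw [max_eq_left (by nlinarith)] at h0 h1
          rw [abs_of_nonpos hm] at h1
          rcases ht with rfl | rfl <;> linarith
        · rw [max_eq_right (by nlinarith)] at h0 h1
          rw [abs_of_nonneg hm] at h1
          rcases ht with rfl | rfl <;> linarith)
    refine ⟨F, mem_distributionsBetween hA hB (hAt'.trans hAF) (hFB.trans htB')
      (RectUnion.volume_nonneg_of_weights hF), le_antisymm ?_ ?_⟩
    · simpa using hFB x
    · simpa using hAF x
  constructor
  · intro x
    refine IsLeast.isGLB ⟨key x _ le_rfl (hAB x) (Or.inl rfl), ?_⟩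
    rintro _ ⟨F, hF, rfl⟩
    exact hF.2.1 x
  · intro x
    refine IsGreatest.isLUB ⟨key x _ (hAB x) le_rfl (Or.inr rfl), ?_⟩
    rintro _ ⟨F, hF, rfl⟩
    exact hF.2.2 x

/-! ### Copulas -/

/-- Rectangles with a side on an axis give monotonicity; those with a side at `1` bound the
increments by those of the uniform margins. -/
theorem IsCopula.isQuasiCopula {C : unitInterval × unitInterval → ℝ} (hC : IsCopula C) :
    IsQuasiCopula C := by
  have h2 := twoIncreasing_iff.2 hC.volume_nonneg
  have hl := h2.mono_left hC.zero_right
  have hr := h2.swap.mono_left hC.zero_left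
  have key1 : ∀ u u' v, |C (u, v) - C (u', v)| ≤ |(u : ℝ) - u'| := by
    intro u u' v
    rcases le_total u u' with h | h
    · have e : (u : ℝ) ≤ u' := h
      have := h2.sub_le h v
      rw [show (⊤ : unitInterval) = 1 from rfl, hC.one_right, hC.one_right] at this
      rw [abs_sub_comm, abs_of_nonneg (sub_nonneg.2 (hl v h)), abs_sub_comm (u : ℝ),
        abs_of_nonneg (sub_nonneg.2 e)]
      exact this
    · have e : (u' : ℝ) ≤ u := h
      have := h2.sub_le h v
      rw [show (⊤ : unitInterval) = 1 from rfl, hC.one_right, hC.one_right] at this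
      rw [abs_of_nonneg (sub_nonneg.2 (hl v h)), abs_of_nonneg (sub_nonneg.2 e)]
      exact this
  have key2 : ∀ u v v', |C (u, v) - C (u, v')| ≤ |(v : ℝ) - v'| := by
    intro u v v'
    rcases le_total v v' with h | h
    · have e : (v : ℝ) ≤ v' := h
      have := h2.swap.sub_le h u
      rw [show (⊤ : unitInterval) = 1 from rfl, hC.one_left, hC.one_left] at this
      rw [abs_sub_comm, abs_of_nonneg (sub_nonneg.2 (hr u h)), abs_sub_comm (v : ℝ),
        abs_of_nonneg (sub_nonneg.2 e)]
      exact this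
    · have e : (v' : ℝ) ≤ v := h
      have := h2.swap.sub_le h u
      rw [show (⊤ : unitInterval) = 1 from rfl, hC.one_left, hC.one_left] at this
      rw [abs_of_nonneg (sub_nonneg.2 (hr u h)), abs_of_nonneg (sub_nonneg.2 e)]
      exact this
  exact ⟨hC.toHasCopulaBoundary, fun u u' v h => hl v h, fun u v v' h => hr u h,
    fun u u' v v' => (abs_sub_le _ (C (u', v)) _).trans (add_le_add (key1 u u' v) (key2 u' v v'))⟩

section Envelopes

variable {S : Set (unitInterval × unitInterval → ℝ)} {P : unitInterval × unitInterval → ℝ}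

/-- Monotonicity and the Lipschitz bound are inequalities uniform in `C`, so they pass to the
infimum. -/
theorem isQuasiCopula_of_isPointwiseInf (hne : S.Nonempty) (hS : ∀ C ∈ S, IsQuasiCopula C)
    (hP : IsPointwiseInf S P) : IsQuasiCopula P := by
  obtain ⟨C₀, hC₀⟩ := hne
  have hle : ∀ C ∈ S, ∀ u, P u ≤ C u := fun C hC u => (hP u).1 ⟨C, hC, rfl⟩
  have hge : ∀ {u c}, (∀ C ∈ S, c ≤ C u) → c ≤ P u := fun {u c} h => (hP u).2 (by
    rintro _ ⟨C, hC, rfl⟩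
    exact h C hC)
  have hconst : ∀ {u c}, (∀ C ∈ S, C u = c) → P u = c := fun h =>
    le_antisymm ((hle C₀ hC₀ _).trans_eq (h C₀ hC₀)) (hge fun C hC => (h C hC).ge)
  refine ⟨⟨fun u => ⟨hge fun C hC => ((hS C hC).mem_Icc u).1,
    (hle C₀ hC₀ u).trans ((hS C₀ hC₀).mem_Icc u).2⟩,
    fun u => hconst fun C hC => (hS C hC).zero_right u,
    fun u => hconst fun C hC => (hS C hC).zero_left u,
    fun u => hconst fun C hC => (hS C hC).one_right u,
    fun u => hconst fun C hC => (hS C hC).one_left u⟩,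
    fun u u' v h => hge fun C hC => (hle C hC _).trans ((hS C hC).mono_left u u' v h),
    fun u v v' h => hge fun C hC => (hle C hC _).trans ((hS C hC).mono_right u v v' h), ?_⟩
  have key : ∀ u u' v v' : unitInterval,
      P (u, v) - (|(u : ℝ) - u'| + |(v : ℝ) - v'|) ≤ P (u', v') := fun u u' v v' =>
    hge fun C hC => by
      have h1 := le_of_abs_le ((hS C hC).lipschitz u u' v v')
      have h2 := hle C hC (u, v)
      linarith
  intro u u' v v'
  have h1 := key u u' v v'
  have h2 := key u' u v' v
  rw [abs_sub_comm (u' : ℝ), abs_sub_comm (v' : ℝ)] at h2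
  rw [abs_le]
  constructor <;> linarith

theorem isQuasiCopula_of_isPointwiseSup (hne : S.Nonempty) (hS : ∀ C ∈ S, IsQuasiCopula C)
    (hP : IsPointwiseSup S P) : IsQuasiCopula P := by
  obtain ⟨C₀, hC₀⟩ := hne
  have hle : ∀ C ∈ S, ∀ u, C u ≤ P u := fun C hC u => (hP u).1 ⟨C, hC, rfl⟩
  have hge : ∀ {u c}, (∀ C ∈ S, C u ≤ c) → P u ≤ c := fun {u c} h => (hP u).2 (by
    rintro _ ⟨C, hC, rfl⟩
    exact h C hC)
  have hconst : ∀ {u c}, (∀ C ∈ S, C u = c) → P u = c := fun h =>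
    le_antisymm (hge fun C hC => (h C hC).le) ((h C₀ hC₀).ge.trans (hle C₀ hC₀ _))
  refine ⟨⟨fun u => ⟨((hS C₀ hC₀).mem_Icc u).1.trans (hle C₀ hC₀ u),
    hge fun C hC => ((hS C hC).mem_Icc u).2⟩,
    fun u => hconst fun C hC => (hS C hC).zero_right u,
    fun u => hconst fun C hC => (hS C hC).zero_left u,
    fun u => hconst fun C hC => (hS C hC).one_right u,
    fun u => hconst fun C hC => (hS C hC).one_left u⟩,
    fun u u' v h => hge fun C hC => ((hS C hC).mono_left u u' v h).trans (hle C hC _),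
    fun u v v' h => hge fun C hC => ((hS C hC).mono_right u v v' h).trans (hle C hC _), ?_⟩
  have key : ∀ u u' v v' : unitInterval,
      P (u, v) ≤ P (u', v') + (|(u : ℝ) - u'| + |(v : ℝ) - v'|) := fun u u' v v' =>
    hge fun C hC => by
      have h1 := le_of_abs_le ((hS C hC).lipschitz u u' v v')
      have h2 := hle C hC (u', v')
      linarith
  intro u u' v v'
  have h1 := key u u' v v'
  have h2 := key u' u v' v
  rw [abs_sub_comm (u' : ℝ), abs_sub_comm (v' : ℝ)] at h2
  rw [abs_le]
  constructor <;> linarith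

/-- The pointwise infimum and supremum of a nonempty set of copulas form a coherent pair. -/
theorem isCoherentPair_of_isPointwise {Q : unitInterval × unitInterval → ℝ} (hne : S.Nonempty)
    (hS : ∀ C ∈ S, IsCopula C) (hP : IsPointwiseInf S P) (hQ : IsPointwiseSup S Q) :
    IsCoherentPair P Q := by
  have hsub : S ⊆ copulasBetween P Q := fun C hC =>
    ⟨hS C hC, fun u => (hP u).1 ⟨C, hC, rfl⟩, fun u => (hQ u).1 ⟨C, hC, rfl⟩⟩
  refine ⟨isQuasiCopula_of_isPointwiseInf hne (fun C hC => (hS C hC).isQuasiCopula) hP,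
    isQuasiCopula_of_isPointwiseSup hne (fun C hC => (hS C hC).isQuasiCopula) hQ, ?_,
    fun u => ⟨?_, fun c hc => (hP u).2 (lowerBounds_mono_set (Set.image_mono hsub) hc)⟩,
    fun u => ⟨?_, fun c hc => (hQ u).2 (upperBounds_mono_set (Set.image_mono hsub) hc)⟩⟩
  · obtain ⟨C, hC⟩ := hne
    exact (hsub hC).2.1.trans (hsub hC).2.2
  · rintro _ ⟨C, hC, rfl⟩
    exact hC.2.1 u
  · rintro _ ⟨C, hC, rfl⟩
    exact hC.2.2 u

end Envelopes

/-! ### Sklar's theorem -/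

section Sklar

variable {FX FY : EReal → unitInterval}

/-- Sklar's theorem for distributions without any one-sided continuity. -/
theorem exists_copula (hFX : IsUnivariateDistribution FX) (hFY : IsUnivariateDistribution FY)
    {F : EReal × EReal → ℝ} (hF : F ∈ distributions FX FY) :
    ∃ C, IsCopula C ∧ F = compose C FX FY := by
  obtain ⟨hF, hX, hY⟩ := hF
  obtain ⟨H, hH2, hHbot, hHtop, hHF⟩ := (twoIncreasing_iff.2 hF.volume_nonneg).exists_extension
    hF.bot_right hFX.mono hFX.bot hFX.top hX
  -- The second variable is extended after a swap. As `0 = FX ⊥` and `1 = FX ⊤`, the boundary values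
  -- of `H` in the first variable are those of `F`.
  obtain ⟨C, hC2, hCbot, hCtop, hCH⟩ := hH2.swap.exists_extension (f := FY)
    (fun y => (congrArg (H · y) hFX.bot.symm).trans ((hHF ⊥ y).trans (hF.bot_left y)))
    hFY.mono hFY.bot hFY.top
    (fun y => (congrArg (H · y) hFX.top.symm).trans ((hHF ⊤ y).trans (hY y)))
  have hzero : ∀ u, C 0 u = 0 := fun u => by rw [← hFY.bot, hCH, hHbot]
  have hone : ∀ u, C 1 u = u := fun u => by rw [← hFY.top, hCH, hHtop]
  have hmono : ∀ u, Monotone fun v => C v u := hC2.mono_left hCbot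
  refine ⟨fun u => C u.2 u.1, ⟨⟨fun u => ⟨?_, ?_⟩, fun u => hzero u, fun v => hCbot v,
    fun u => hone u, fun v => hCtop v⟩, twoIncreasing_iff.1 hC2.swap⟩,
    funext fun x => ?_⟩
  · exact (hzero u.1).ge.trans (hmono u.1 u.2.2.1)
  · exact (hmono u.1 u.2.2.2).trans ((hone u.1).trans_le u.1.2.2)
  · simp only [compose]
    rw [hCH, hHF]

theorem hasMargins_compose (hFX : IsUnivariateDistribution FX)
    (hFY : IsUnivariateDistribution FY) {C : unitInterval × unitInterval → ℝ}
    (hC : HasCopulaBoundary C) : HasMargins FX FY (compose C FX FY) :=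
  ⟨fun x => by simp [compose, hFY.top, hC.one_right],
    fun y => by simp [compose, hFX.top, hC.one_left]⟩

theorem isNormalized_compose (hFX : IsUnivariateDistribution FX)
    (hFY : IsUnivariateDistribution FY) {C : unitInterval × unitInterval → ℝ}
    (hC : HasCopulaBoundary C) : IsNormalized (compose C FX FY) :=
  ⟨fun _ => hC.mem_Icc _, fun x => by simp [compose, hFY.bot, hC.zero_right],
    fun y => by simp [compose, hFX.bot, hC.zero_left],
    by simp [compose, hFX.top, hFY.top, hC.one_left]⟩

theorem IsCopula.compose_mem_distributions (hFX : IsUnivariateDistribution FX)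
    (hFY : IsUnivariateDistribution FY) {C : unitInterval × unitInterval → ℝ}
    (hC : IsCopula C) : compose C FX FY ∈ distributions FX FY :=
  ⟨⟨isNormalized_compose hFX hFY hC.toHasCopulaBoundary,
    twoIncreasing_iff.1 ((twoIncreasing_iff.2 hC.volume_nonneg).comp hFX.mono hFY.mono)⟩,
    hasMargins_compose hFX hFY hC.toHasCopulaBoundary⟩

theorem IsQuasiCopula.compose_mem_quasiDistributions (hFX : IsUnivariateDistribution FX)
    (hFY : IsUnivariateDistribution FY) {C : unitInterval × unitInterval → ℝ}
    (hC : IsQuasiCopula C) : compose C FX FY ∈ quasiDistributions FX FY := by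
  refine ⟨⟨isNormalized_compose hFX hFY hC.toHasCopulaBoundary, ?_⟩,
    hasMargins_compose hFX hFY hC.toHasCopulaBoundary⟩
  rintro ⟨⟨x, y⟩, ⟨x', y'⟩, hx, hy⟩ ⟨z, ⟨hz1, hz2⟩, hz⟩
  have hux := hFX.mono hx.le
  have huy := hFY.mono hy.le
  simp only [Rect.volume, Rect.b, Rect.d, compose]
  simp only at hux huy hx hy hz1 hz2
  -- A rectangle that meets the boundary has a side on it. A side at `⊥` reduces the volume to one
  -- increment of `C`, nonnegative by monotonicity; a side at `⊤` makes it a margin increment minus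
  -- an increment of `C`, nonnegative by the Lipschitz bound.
  rcases hz with hz | hz | hz | hz
  · have : x = ⊥ := le_bot_iff.1 (hz ▸ hz1.1)
    rw [this, hFX.bot, hC.zero_left, hC.zero_left]
    linarith [hC.mono_right (FX x') _ _ huy]
  · have : x' = ⊤ := top_le_iff.1 (hz ▸ hz2.1)
    rw [this, hFX.top, hC.one_left, hC.one_left]
    have h := hC.lipschitz (FX x) (FX x) (FY y') (FY y)
    rw [sub_self, abs_zero, zero_add,
      abs_of_nonneg (sub_nonneg.2 (show (FY y : ℝ) ≤ FY y' from huy))] at h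
    linarith [le_of_abs_le h]
  · have : y = ⊥ := le_bot_iff.1 (hz ▸ hz1.2)
    rw [this, hFY.bot, hC.zero_right, hC.zero_right]
    linarith [hC.mono_left _ _ (FY y') hux]
  · have : y' = ⊤ := top_le_iff.1 (hz ▸ hz2.2)
    rw [this, hFY.top, hC.one_right, hC.one_right]
    have h := hC.lipschitz (FX x') (FX x) (FY y) (FY y)
    rw [sub_self, abs_zero, add_zero,
      abs_of_nonneg (sub_nonneg.2 (show (FX x : ℝ) ≤ FX x' from hux))] at h
    linarith [le_of_abs_le h]

/-- By Sklar's theorem the copulas in `S` and the distributions have the same values over the range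
of the margins. Taking the envelopes of `S` on the whole square also settles the points off that
range. -/
theorem EnvelopeCondition.copulaCondition (hFX : IsUnivariateDistribution FX)
    (hFY : IsUnivariateDistribution FY) {A B : EReal × EReal → ℝ}
    (h : EnvelopeCondition FX FY A B) : CopulaCondition FX FY A B := by
  set S := {C | IsCopula C ∧ compose C FX FY ∈ distributionsBetween FX FY A B} with hS
  have himage : ∀ x : EReal × EReal, (fun F : EReal × EReal → ℝ => F x) ''
      distributionsBetween FX FY A B = (fun C => C (FX x.1, FY x.2)) '' S := by
    intro x
    ext c
    constructor
    · rintro ⟨F, hF, rfl⟩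
      obtain ⟨C, hC, rfl⟩ := exists_copula hFX hFY hF.1
      exact ⟨C, ⟨hC, hF⟩, rfl⟩
    · rintro ⟨C, hC, rfl⟩
      exact ⟨_, hC.2, rfl⟩
  have hne : S.Nonempty := by
    -- The empty set has no greatest lower bound in `ℝ`.
    have := (h.1 (⊥, ⊥)).nonempty
    rw [himage] at this
    exact this.of_image
  have hP : IsPointwiseInf S fun u => sInf ((fun C => C u) '' S) := fun u =>
    isGLB_csInf (hne.image _) ⟨0, by rintro _ ⟨C, hC, rfl⟩; exact (hC.1.mem_Icc u).1⟩
  have hQ : IsPointwiseSup S fun u => sSup ((fun C => C u) '' S) := fun u =>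
    isLUB_csSup (hne.image _) ⟨1, by rintro _ ⟨C, hC, rfl⟩; exact (hC.1.mem_Icc u).2⟩
  refine ⟨_, _, isCoherentPair_of_isPointwise hne (fun C hC => hC.1) hP hQ,
    funext fun x => ?_, funext fun x => ?_⟩
  · exact (h.1 x).unique (himage x ▸ hP _)
  · exact (h.2 x).unique (himage x ▸ hQ _)

/-- There may be more distributions than those coming from copulas between `P` and `Q`, but all lie
between the bounds by definition, and the latter alone suffice to make the bounds sharp. -/
theorem IsCoherentPair.envelopeCondition (hFX : IsUnivariateDistribution FX)
    (hFY : IsUnivariateDistribution FY) {P Q : unitInterval × unitInterval → ℝ}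
    (h : IsCoherentPair P Q) :
    EnvelopeCondition FX FY (compose P FX FY) (compose Q FX FY) := by
  have hsub : ∀ x : EReal × EReal, (fun C => C (FX x.1, FY x.2)) '' copulasBetween P Q ⊆
      (fun F : EReal × EReal → ℝ => F x) ''
        distributionsBetween FX FY (compose P FX FY) (compose Q FX FY) := by
    rintro x _ ⟨C, hC, rfl⟩
    exact ⟨compose C FX FY, ⟨hC.1.compose_mem_distributions hFX hFY,
      fun y => hC.2.1 _, fun y => hC.2.2 _⟩, rfl⟩
  refine ⟨fun x => ⟨?_, fun c hc => (h.eq_inf _).2 (lowerBounds_mono_set (hsub x) hc)⟩,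
    fun x => ⟨?_, fun c hc => (h.eq_sup _).2 (upperBounds_mono_set (hsub x) hc)⟩⟩
  · rintro _ ⟨F, hF, rfl⟩
    exact hF.2.1 x
  · rintro _ ⟨F, hF, rfl⟩
    exact hF.2.2 x

end Sklar

end ImpreciseSklar

theorem theorem4p1 (FX FY : EReal → unitInterval)
    (hFX : ImpreciseSklar.IsUnivariateDistribution FX)
    (hFY : ImpreciseSklar.IsUnivariateDistribution FY) :
    (∀ A ∈ ImpreciseSklar.quasiDistributions FX FY,
      ∀ B ∈ ImpreciseSklar.quasiDistributions FX FY, A ≤ B →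
        List.TFAE
          [ImpreciseSklar.VolumeCondition A B,
            ImpreciseSklar.EnvelopeCondition FX FY A B,
            ImpreciseSklar.CopulaCondition FX FY A B]) ∧
    (∀ P Q : unitInterval × unitInterval → ℝ, ImpreciseSklar.IsCoherentPair P Q →
      ImpreciseSklar.compose P FX FY ∈ ImpreciseSklar.quasiDistributions FX FY ∧
      ImpreciseSklar.compose Q FX FY ∈ ImpreciseSklar.quasiDistributions FX FY ∧
      ImpreciseSklar.compose P FX FY ≤ ImpreciseSklar.compose Q FX FY ∧
      ImpreciseSklar.VolumeCondition
        (ImpreciseSklar.compose P FX FY) (ImpreciseSklar.compose Q FX FY) ∧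
      ImpreciseSklar.EnvelopeCondition FX FY
        (ImpreciseSklar.compose P FX FY) (ImpreciseSklar.compose Q FX FY) ∧
      ImpreciseSklar.CopulaCondition FX FY
        (ImpreciseSklar.compose P FX FY) (ImpreciseSklar.compose Q FX FY)) := by
  refine ⟨fun A hA B hB hAB => ?_, fun P Q h => ?_⟩
  · tfae_have 1 → 2 := fun h => h.envelopeCondition hA hB hAB
    tfae_have 2 → 1 := fun h => h.volumeCondition hAB
    tfae_have 2 → 3 := fun h => h.copulaCondition hFX hFY
    tfae_have 3 → 2 := by
      rintro ⟨P, Q, h, rfl, rfl⟩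
      exact h.envelopeCondition hFX hFY
    tfae_finish
  · have hle : ImpreciseSklar.compose P FX FY ≤ ImpreciseSklar.compose Q FX FY :=
      fun x => h.le _
    have henv := h.envelopeCondition hFX hFY
    exact ⟨h.quasi_left.compose_mem_quasiDistributions hFX hFY,
      h.quasi_right.compose_mem_quasiDistributions hFX hFY, hle,
      henv.volumeCondition hle, henv, P, Q, h, rfl, rfl⟩
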